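/- Let $d\ge 1$, $S=\mathbb R^d_+$, $\theta\in\mathbb R^d$, let $\Gamma$ be a symmetric positive definite $d\times d$ matrix and $R$ a completely-$\mathcal S$ $d\times d$ matrix, i.e. for every principal submatrix $M$ of $R$ there is a vector $w\ge 0$ with all components of $Mw$ positive. Let $Z$, together with probability measures $\{\mathbb P_x, x\in S\}$ on a filtered space $(\Omega,\mathcal F,\{\mathcal F_t\})$, be a semimartingale reflecting Brownian motion (SRBM) with data $(S,\theta,\Gamma,R)$: $Z$ is a continuous adapted process and, for each $x\in S$, $\mathbb P_x$-a.s. $Z(t)\in S$ and $Z(t)=W(t)+\theta t+RY(t)$ for all $t\ge 0$, where under $\mathbb P_x$ the process $W$ is a driftless $d$-dimensional Brownian motion with covariance matrix $\Gamma$ and $W(0)=x$, which is an $\{\mathcal F_t\}$-martingale, and $Y$ is adapted and $\mathbb P_x$-a.s. each component $Y_i$ is continuous and nondecreasing with $Y_i(0)=0$ and $\int_0^t 1_{\{Z_i(s)\ne 0\}}\,dY_i(s)=0$ for all $t\ge 0$. For $A\subseteq\mathbb R^d$ put $\tau_A=\inf\{t\ge0: Z(t)\in A\}\in[0,\infty]$,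 and put $A_1=\{z\in S:|z|\le 1\}$. Then: (a) If $Z$ is positive recurrent, either in the sense that $\mathbb E_x(\tau_A)<\infty$ for all $x\in S$ and all closed $A\subseteq S$ of positive Lebesgue measure, or in the sense that $\mathbb E_x(\tau_A)<\infty$ for all $x\in S$ and all open neighbourhoods $A$ of the origin, then $R$ is nonsingular and every component of $R^{-1}\theta$ is negative. (b) Suppose $R$ is nonsingular and $(R^{-1}\theta)_i\ge 0$ for some $i$, and let $u$ be the $i$th row of $R^{-1}$. Then for each $x\in S$ there is, under $\mathbb P_x$, a one-dimensional Brownian motion $\beta$ with $\beta(0)=u\cdot x$, drift $(R^{-1}\theta)_i\ge 0$ and variance parameter $u\cdot\Gamma u>0$ such that $\mathbb P_x$-a.s. $u\cdot Z(t)\ge\beta(t)$ for all $t\ge 0$. Moreover there is $x\in S$ with $|x|>1$ and $u\cdot x>u\cdot z$ for all $z\in A_1$ such that $\mathbb E_x(\tau_{A_1})=\infty$. (c) Suppose $R$ is singular. Then there is $u\ne 0$ with $u'R=0$ and $u\cdot\theta\ge0$ such that for each $x\in S$ the process $u\cdot Z$ is, under $\mathbb P_x$, a one-dimensional Brownian motion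 started at $u\cdot x$ with drift $u\cdot\theta\ge 0$ and variance parameter $u\cdot\Gamma u>0$. Moreover there is $x\in S$ with $|x|>1$ and $u\cdot x>u\cdot z$ for all $z\in A_1$ such that $\mathbb E_x(\tau_{A_1})=\infty$. -/

import Mathlib

open MeasureTheory ProbabilityTheory
open scoped NNReal ENNReal Matrix

noncomputable section

/-- The nonnegative orthant `S = ℝ₊ᵈ`, inside `ℝᵈ` with its Euclidean norm. -/
def orthant (d : ℕ) : Set (EuclideanSpace ℝ (Fin d)) :=
  {z | ∀ i, 0 ≤ z i}

/-- `M` is an `𝒮`-matrix: there is a vector `w ≥ 0` with `M w > 0`. -/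
def IsSMatrix {ι : Type*} [Fintype ι] (M : Matrix ι ι ℝ) : Prop :=
  ∃ w : ι → ℝ, (∀ i, 0 ≤ w i) ∧ ∀ i, 0 < (M *ᵥ w) i

/-- `R` is completely-`𝒮`: every principal submatrix is an `𝒮`-matrix. -/
def IsCompletelyS {d : ℕ} (R : Matrix (Fin d) (Fin d) ℝ) : Prop :=
  ∀ J : Finset (Fin d), J.Nonempty →
    IsSMatrix (R.submatrix (fun j : J => (j : Fin d)) (fun j : J => (j : Fin d)))

/-- `W` is, under `P`, a driftless `d`-dimensional Brownian motion with covariance matrix `Γ`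
started at `x`. -/
structure IsBrownianMotionFrom {d : ℕ} {Ω : Type*} [MeasurableSpace Ω]
    (x : EuclideanSpace ℝ (Fin d)) (Γ : Matrix (Fin d) (Fin d) ℝ)
    (W : ℝ≥0 → Ω → EuclideanSpace ℝ (Fin d)) (P : Measure Ω) : Prop where
  start : ∀ᵐ ω ∂P, W 0 ω = x
  cont : ∀ᵐ ω ∂P, Continuous fun t => W t ω
  indep : HasIndepIncrements W P
  law : ∀ s h : ℝ≥0,
    HasLaw (fun ω => W (s + h) ω - W s ω) (multivariateGaussian 0 ((h : ℝ) • Γ)) P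

/-- `β` is, under `P`, a (nondegenerate) one-dimensional Brownian motion started at `b` with
drift `m` and variance parameter `v > 0`: `β(t) = b + √v B(t) + m t` for a standard Brownian
motion `B`. -/
def IsLinearBrownianMotion {Ω : Type*} [MeasurableSpace Ω] (b m v : ℝ) (β : ℝ≥0 → Ω → ℝ)
    (P : Measure Ω) : Prop :=
  0 < v ∧ ∃ B : ℝ≥0 → Ω → ℝ, IsBrownianReal B P ∧
    ∀ᵐ ω ∂P, ∀ t : ℝ≥0, β t ω = b + Real.sqrt v * B t ω + m * (t : ℝ)

/-- The conditions on the pushing process along one path, for one coordinate: `y` is continuous and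
nondecreasing with `y 0 = 0`, and `∫₀ᵗ 1{z(s) ≠ 0} dy(s) = 0` for all `t ≥ 0`
(Lebesgue–Stieltjes integral). -/
def IsPushingPath (y z : ℝ≥0 → ℝ) : Prop :=
  Continuous y ∧ y 0 = 0 ∧ ∃ hy : Monotone y, ∀ t : ℝ≥0,
    ∫⁻ s in Set.Icc 0 t, Set.indicator {s | z s ≠ 0} (fun _ => (1 : ℝ≥0∞)) s
      ∂hy.stieltjesFunction.measure = 0

/-- Under the probability measure `P`, the process `Z` is represented as
`Z(t) = W(t) + θ t + R Y(t)`, with `W` a Brownian motion from `x` and `Y` the pushing process. -/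
structure IsSRBMRepresentation {d : ℕ} {Ω : Type*} [MeasurableSpace Ω]
    (𝓕 : Filtration ℝ≥0 ‹MeasurableSpace Ω›)
    (θ : EuclideanSpace ℝ (Fin d)) (Γ R : Matrix (Fin d) (Fin d) ℝ)
    (Z : ℝ≥0 → Ω → EuclideanSpace ℝ (Fin d)) (x : EuclideanSpace ℝ (Fin d)) (P : Measure Ω)
    (W Y : ℝ≥0 → Ω → EuclideanSpace ℝ (Fin d)) : Prop where
  brownian : IsBrownianMotionFrom x Γ W P
  martingale : Martingale W 𝓕 P
  adapted : StronglyAdapted 𝓕 Y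
  pushing : ∀ᵐ ω ∂P, ∀ i, IsPushingPath (fun t => Y t ω i) (fun t => Z t ω i)
  decomposition : ∀ᵐ ω ∂P, ∀ (t : ℝ≥0) (i : Fin d),
    Z t ω i = W t ω i + θ i * (t : ℝ) + ∑ j, R i j * Y t ω j

/-- The adapted process `Z` together with the probability measures `(P x)`, `x ∈ S`, is an SRBM
with data `(S, θ, Γ, R)`, on the filtered space `(Ω, 𝓕)`. -/
structure IsSRBM {d : ℕ} {Ω : Type*} [MeasurableSpace Ω]
    (𝓕 : Filtration ℝ≥0 ‹MeasurableSpace Ω›)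
    (θ : EuclideanSpace ℝ (Fin d)) (Γ R : Matrix (Fin d) (Fin d) ℝ)
    (Z : ℝ≥0 → Ω → EuclideanSpace ℝ (Fin d)) (P : orthant d → Measure Ω) : Prop where
  isProb : ∀ x, IsProbabilityMeasure (P x)
  adapted : StronglyAdapted 𝓕 Z
  cont : ∀ x, ∀ᵐ ω ∂P x, Continuous fun t => Z t ω
  mem_orthant : ∀ x, ∀ᵐ ω ∂P x, ∀ t, Z t ω ∈ orthant d
  representation : ∀ x : orthant d, ∃ W Y : ℝ≥0 → Ω → EuclideanSpace ℝ (Fin d),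
    IsSRBMRepresentation 𝓕 θ Γ R Z x (P x) W Y

/-- `τ_A = inf {t ≥ 0 : Z(t) ∈ A}`, equal to `∞` when `A` is never visited. -/
def hitTime {d : ℕ} {Ω : Type*} (Z : ℝ≥0 → Ω → EuclideanSpace ℝ (Fin d))
    (A : Set (EuclideanSpace ℝ (Fin d))) (ω : Ω) : ℝ≥0∞ :=
  ⨅ (t : ℝ≥0) (_ : Z t ω ∈ A), (t : ℝ≥0∞)

/-- Positive recurrence: `E_x(τ_A) < ∞` for each `x ∈ S` and each closed `A ⊆ S` having positive
Lebesgue measure. -/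
def IsPositiveRecurrent {d : ℕ} {Ω : Type*} [MeasurableSpace Ω]
    (Z : ℝ≥0 → Ω → EuclideanSpace ℝ (Fin d)) (P : orthant d → Measure Ω) : Prop :=
  ∀ A : Set (EuclideanSpace ℝ (Fin d)), A ⊆ orthant d → IsClosed A → 0 < volume A →
    ∀ x, ∫⁻ ω, hitTime Z A ω ∂P x < ∞

/-- Positive recurrence through neighbourhoods of the origin: `E_x(τ_A) < ∞` for each `x ∈ S` and
each open neighbourhood `A` of the origin. -/
def IsPositiveRecurrentAtOrigin {d : ℕ} {Ω : Type*} [MeasurableSpace Ω]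
    (Z : ℝ≥0 → Ω → EuclideanSpace ℝ (Fin d)) (P : orthant d → Measure Ω) : Prop :=
  ∀ A : Set (EuclideanSpace ℝ (Fin d)), IsOpen A → 0 ∈ A →
    ∀ x, ∫⁻ ω, hitTime Z A ω ∂P x < ∞

/-- `{z ∈ S : |z| ≤ 1}`, a neighbourhood of the origin in `S`. -/
def orthantBall (d : ℕ) : Set (EuclideanSpace ℝ (Fin d)) :=
  {z | z ∈ orthant d ∧ ‖z‖ ≤ 1}

/-- There is a starting point `x ∈ S` with `|x| > 1` and `u · x > u · z` for all `z` in
`A = {z ∈ S : |z| ≤ 1}`, from which `E_x(τ_A) = ∞`. -/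
def HasInfiniteMeanStart {d : ℕ} {Ω : Type*} [MeasurableSpace Ω]
    (Z : ℝ≥0 → Ω → EuclideanSpace ℝ (Fin d)) (P : orthant d → Measure Ω)
    (u : Fin d → ℝ) : Prop :=
  ∃ x : orthant d, 1 < ‖(x : EuclideanSpace ℝ (Fin d))‖ ∧
    (∀ z ∈ orthantBall d, u ⬝ᵥ z.ofLp < u ⬝ᵥ x.1.ofLp) ∧
    ∫⁻ ω, hitTime Z (orthantBall d) ω ∂P x = ∞

end

/-! If `R` is singular, or some component of `R⁻¹ θ` is nonnegative, there is `u ≠ 0` with `u' R ≥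
0` and `u · θ ≥ 0`: a left null vector of suitable sign, or a row of `R⁻¹`. Since `Y ≥ 0`, `u · Z(t)
≥ u · W(t) + (u · θ) t`, a Brownian motion with nonnegative drift. The 𝒮-property of `R` gives `u` a
positive coordinate, so some `x` in the orthant satisfies `u · x > c > u · z` for all `z` in the
unit ball of the orthant, and the ball cannot be hit while `X = u · W - c` is nonnegative.

The infinite mean (`lintegral_hitTime_eq_top`) needs only that `X` is a square integrable
martingale. With `a = u · x - c` and `v = u · Γ u`, optional stopping gives `E[X(t); X > 0 up to t]
≥ a`, and a second-moment bound then gives `P(X > 0 up to t) ≥ a² / (a² + v t)`. This tail decays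
only harmonically, so its sum over integer times diverges. Both kinds of positive recurrence are
thereby excluded. -/

/-! ### Linear projections of Brownian motion. -/

lemma Matrix.PosDef.dotProduct_mulVec_self_pos {ι : Type*} [Fintype ι] {Γ : Matrix ι ι ℝ}
    (hΓ : Γ.PosDef) {u : ι → ℝ} (hu : u ≠ 0) : 0 < u ⬝ᵥ Γ *ᵥ u := by
  simpa using hΓ.dotProduct_mulVec_pos hu

/-- The linear functional `z ↦ u · z` on Euclidean space. -/
noncomputable def dotProductCLM {ι : Type*} [Fintype ι] (u : ι → ℝ) :
    EuclideanSpace ℝ ι →L[ℝ] ℝ :=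
  innerSL ℝ (WithLp.toLp 2 u)

lemma dotProductCLM_apply {ι : Type*} [Fintype ι] (u : ι → ℝ) (z : EuclideanSpace ℝ ι) :
    dotProductCLM u z = u ⬝ᵥ z.ofLp := by
  simp [dotProductCLM, innerSL_apply_apply, EuclideanSpace.inner_eq_star_dotProduct,
    dotProduct_comm]

lemma map_dotProductCLM_multivariateGaussian {ι : Type*} [Fintype ι] [DecidableEq ι]
    {S : Matrix ι ι ℝ} (hS : S.PosSemidef) (u : ι → ℝ) :
    (multivariateGaussian 0 S).map (dotProductCLM u) =
      gaussianReal 0 (u ⬝ᵥ S *ᵥ u).toNNReal := by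
  rw [IsGaussian.map_eq_gaussianReal]
  congr 2
  · rw [(dotProductCLM u).integral_comp_id_comm IsGaussian.integrable_id]
    simp
  · have h := covarianceBilin_self (IsGaussian.memLp_two_id (μ := multivariateGaussian 0 S))
      (WithLp.toLp 2 u)
    rw [covarianceBilin_multivariateGaussian hS] at h
    exact h.symm

namespace IsBrownianMotionFrom

variable {d : ℕ} {Ω : Type*} [MeasurableSpace Ω] {x : EuclideanSpace ℝ (Fin d)}
  {Γ : Matrix (Fin d) (Fin d) ℝ} {W : ℝ≥0 → Ω → EuclideanSpace ℝ (Fin d)} {P : Measure Ω}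

lemma hasLaw_dotProduct_sub (hW : IsBrownianMotionFrom x Γ W P) (hΓ : Γ.PosDef)
    (u : Fin d → ℝ) (t : ℝ≥0) :
    HasLaw (fun ω => u ⬝ᵥ (W t ω).ofLp - u ⬝ᵥ x.ofLp)
      (gaussianReal 0 ((t : ℝ) * (u ⬝ᵥ Γ *ᵥ u)).toNNReal) P := by
  have hS : ((t : ℝ) • Γ).PosSemidef := hΓ.posSemidef.smul t.2
  have h1 : HasLaw (dotProductCLM u) (gaussianReal 0 ((t : ℝ) * (u ⬝ᵥ Γ *ᵥ u)).toNNReal)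
      (multivariateGaussian 0 ((t : ℝ) • Γ)) := by
    refine ⟨(dotProductCLM u).measurable.aemeasurable, ?_⟩
    rw [map_dotProductCLM_multivariateGaussian hS, Matrix.smul_mulVec, dotProduct_smul,
      smul_eq_mul]
  refine (h1.comp (hW.law 0 t)).congr ?_
  filter_upwards [hW.start] with ω hω
  simp [hω, dotProductCLM_apply]

lemma hasIndepIncrements_dotProduct_sub (hW : IsBrownianMotionFrom x Γ W P)
    (u : Fin d → ℝ) (c : ℝ) :
    HasIndepIncrements (fun t ω => (√c)⁻¹ * (u ⬝ᵥ (W t ω).ofLp - u ⬝ᵥ x.ofLp)) P := by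
  intro n t ht
  have h := (hW.indep.map ((√c)⁻¹ • dotProductCLM u)) n t ht
  convert h using 3
  simp [dotProductCLM_apply]
  ring

lemma isBrownianReal_dotProduct (hW : IsBrownianMotionFrom x Γ W P) (hΓ : Γ.PosDef)
    {u : Fin d → ℝ} (hu : u ≠ 0) :
    IsBrownianReal (fun t ω => (√(u ⬝ᵥ Γ *ᵥ u))⁻¹ * (u ⬝ᵥ (W t ω).ofLp - u ⬝ᵥ x.ofLp)) P where
  toIsPreBrownianReal := by
    refine HasIndepIncrements.isPreBrownianReal_of_hasLaw (fun t => ?_)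
      (hW.hasIndepIncrements_dotProduct_sub u _)
    have hv := hΓ.dotProduct_mulVec_self_pos hu
    convert gaussianReal_const_mul (hW.hasLaw_dotProduct_sub hΓ u t) (√(u ⬝ᵥ Γ *ᵥ u))⁻¹ using 2
    · simp
    · ext
      simp only [NNReal.coe_mul, NNReal.coe_mk]
      rw [Real.coe_toNNReal _ (by positivity), inv_pow, Real.sq_sqrt hv.le]
      field_simp
  cont := by
    filter_upwards [hW.cont] with ω hω
    have : Continuous fun t => dotProductCLM u (W t ω) := (dotProductCLM u).continuous.comp hω
    simp only [dotProductCLM_apply] at this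
    fun_prop

lemma isLinearBrownianMotion_dotProduct (hW : IsBrownianMotionFrom x Γ W P) (hΓ : Γ.PosDef)
    {u : Fin d → ℝ} (hu : u ≠ 0) (m : ℝ) {β : ℝ≥0 → Ω → ℝ}
    (hβ : ∀ᵐ ω ∂P, ∀ t : ℝ≥0, β t ω = u ⬝ᵥ (W t ω).ofLp + m * t) :
    IsLinearBrownianMotion (u ⬝ᵥ x.ofLp) m (u ⬝ᵥ Γ *ᵥ u) β P := by
  have hv := hΓ.dotProduct_mulVec_self_pos hu
  refine ⟨hv, _, hW.isBrownianReal_dotProduct hΓ hu, ?_⟩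
  filter_upwards [hβ] with ω hω t
  rw [hω t, mul_inv_cancel_left₀ (Real.sqrt_ne_zero'.2 hv)]
  ring

lemma memLp_two_dotProduct_sub (hW : IsBrownianMotionFrom x Γ W P) (hΓ : Γ.PosDef)
    (u : Fin d → ℝ) (c : ℝ) (t : ℝ≥0) : MemLp (fun ω => u ⬝ᵥ (W t ω).ofLp - c) 2 P := by
  have h := gaussianReal_add_const (hW.hasLaw_dotProduct_sub hΓ u t) (u ⬝ᵥ x.ofLp - c)
  simpa using h.hasGaussianLaw.memLp_two

lemma integral_dotProduct_sub_sq (hW : IsBrownianMotionFrom x Γ W P) (hΓ : Γ.PosDef)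
    (u : Fin d → ℝ) (c : ℝ) (t : ℝ≥0) :
    ∫ ω, (u ⬝ᵥ (W t ω).ofLp - c) ^ 2 ∂P = (u ⬝ᵥ x.ofLp - c) ^ 2 + (u ⬝ᵥ Γ *ᵥ u) * t := by
  have h := gaussianReal_add_const (hW.hasLaw_dotProduct_sub hΓ u t) (u ⬝ᵥ x.ofLp - c)
  have : IsProbabilityMeasure P := h.isProbabilityMeasure
  simp only [zero_add, sub_add_sub_cancel] at h
  have h1 := h.variance_eq
  have h2 := h.integral_eq
  have hv : 0 ≤ u ⬝ᵥ Γ *ᵥ u := by simpa using hΓ.posSemidef.dotProduct_mulVec_nonneg u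
  rw [variance_eq_sub (hW.memLp_two_dotProduct_sub hΓ u c t), variance_id_gaussianReal,
    Real.coe_toNNReal _ (by positivity)] at h1
  rw [h2, integral_id_gaussianReal] at h1
  simp only [Pi.pow_apply] at h1
  linarith

end IsBrownianMotionFrom

/-! ### Lower bound for the probability that a martingale stays positive. -/

section Martingale

variable {Ω : Type*} {mΩ : MeasurableSpace Ω} {P : Measure Ω}

lemma MeasureTheory.Martingale.continuousLinearMap_comp {ι E F : Type*} [Preorder ι]
    [NormedAddCommGroup E] [NormedSpace ℝ E] [CompleteSpace E]
    [NormedAddCommGroup F] [NormedSpace ℝ F] [CompleteSpace F]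
    {𝓕 : Filtration ι mΩ} {W : ι → Ω → E}
    (hW : Martingale W 𝓕 P) (L : E →L[ℝ] F) : Martingale (fun t ω => L (W t ω)) 𝓕 P := by
  refine ⟨fun t => L.continuous.comp_stronglyMeasurable (hW.stronglyMeasurable t),
    fun s t hst => ?_⟩
  filter_upwards [L.comp_condExp_comm (m := 𝓕 s) (hW.integrable t), hW.condExp_ae_eq hst]
    with ω h1 h2
  exact h1.symm.trans (congrArg L h2)

lemma MeasureTheory.Martingale.measurableSet_forall_pos {ι : Type*} [Preorder ι]
    {𝓕 : Filtration ι mΩ} {X : ι → Ω → ℝ} (hX : Martingale X 𝓕 P) (s : Finset ι) {t : ι}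
    (ht : ∀ r ∈ s, r ≤ t) : MeasurableSet[𝓕 t] {ω | ∀ r ∈ s, 0 < X r ω} := by
  simp only [Set.ofPred_forall]
  refine Finset.measurableSet_biInter s fun r hr => ?_
  exact (((hX.stronglyMeasurable r).measurable.mono (𝓕.mono (ht r hr)) le_rfl) :
    Measurable[𝓕 t] (X r)) measurableSet_Ioi

/-- Optional stopping at the first time in a finite set at which a martingale is nonpositive. -/
lemma MeasureTheory.Martingale.le_setIntegral_forall_pos {ι : Type*} [LinearOrder ι] [OrderBot ι]
    [IsFiniteMeasure P]
    {𝓕 : Filtration ι mΩ} {X : ι → Ω → ℝ} (hX : Martingale X 𝓕 P) (s : Finset ι) :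
    ∀ t, (∀ r ∈ s, r ≤ t) → ∫ ω, X ⊥ ω ∂P ≤ ∫ ω in {ω | ∀ r ∈ s, 0 < X r ω}, X t ω ∂P := by
  induction s using Finset.induction_on_max with
  | empty =>
    intro t _
    have := hX.setIntegral_eq (bot_le : ⊥ ≤ t) MeasurableSet.univ
    simpa using this.le
  | insert m s hm ih =>
    intro t ht
    have hA := hX.measurableSet_forall_pos s (fun r hr => (hm r hr).le)
    have hB := hX.measurableSet_forall_pos (insert m s) (t := m) (by
      simpa using fun r hr => (hm r hr).le)
    rw [← hX.setIntegral_eq (ht m (Finset.mem_insert_self _ _)) hB]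
    -- Both integrals are now at time `m`; passing to the smaller event only discards outcomes with
    -- `X m ≤ 0`.
    refine (ih m fun r hr => (hm r hr).le).trans ?_
    rw [← integral_indicator (𝓕.le m _ hA), ← integral_indicator (𝓕.le m _ hB)]
    refine integral_mono ((hX.integrable m).indicator (𝓕.le m _ hA))
      ((hX.integrable m).indicator (𝓕.le m _ hB)) fun ω => ?_
    simp only [Set.indicator_apply, Set.mem_ofPred_eq, Finset.forall_mem_insert]
    split_ifs <;> grind

/-- If `X ∈ L²` has integral at least `a > 0` over `A`, then `P A ≥ a² / E X²`. -/
lemma le_measureReal_of_le_setIntegral [IsFiniteMeasure P] {X : Ω → ℝ} (hX : MemLp X 2 P)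
    {A : Set Ω} {a q : ℝ} (ha : 0 < a) (hq : 0 < q)
    (hXq : ∫ ω, X ω ^ 2 ∂P ≤ q) (h : a ≤ ∫ ω in A, X ω ∂P) : a ^ 2 / q ≤ P.real A := by
  -- AM-GM in place of Cauchy–Schwarz: the weights make the `X²` term contribute at most `a / 2`,
  -- half of the lower bound.
  have h1 : ∫ ω in A, X ω ∂P ≤ ∫ ω in A, (a / (2 * q) * X ω ^ 2 + q / (2 * a)) ∂P := by
    refine integral_mono (hX.integrable one_le_two).integrableOn
      ((hX.integrable_sq.integrableOn.const_mul _).add (integrable_const _)) fun ω => ?_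
    have : a / (2 * q) * X ω ^ 2 + q / (2 * a) - X ω = (a * X ω - q) ^ 2 / (2 * a * q) := by
      field_simp
      ring
    have : 0 ≤ (a * X ω - q) ^ 2 / (2 * a * q) := by positivity
    dsimp only
    linarith
  have h2 : ∫ ω in A, (a / (2 * q) * X ω ^ 2 + q / (2 * a)) ∂P ≤
      a / (2 * q) * q + P.real A * (q / (2 * a)) := by
    rw [integral_add (hX.integrable_sq.integrableOn.const_mul _) (integrable_const _),
      integral_const_mul, setIntegral_const, smul_eq_mul]
    gcongr
    exact (setIntegral_le_integral hX.integrable_sq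
      (Filter.Eventually.of_forall fun ω => sq_nonneg _)).trans hXq
  have h3 : a ≤ a / 2 + P.real A * (q / (2 * a)) := by
    have : a / (2 * q) * q = a / 2 := by field_simp
    linarith
  rw [div_le_iff₀ hq]
  have h4 : P.real A * (q / (2 * a)) * (2 * a) = P.real A * q := by field_simp
  nlinarith

lemma MeasureTheory.Martingale.measurableSet_forall_seq_pos {𝓕 : Filtration ℝ≥0 mΩ}
    {X : ℝ≥0 → Ω → ℝ} (hX : Martingale X 𝓕 P) (e : ℕ → ℝ≥0) (t : ℝ≥0) :
    MeasurableSet {ω | ∀ n, e n ≤ t → 0 < X (e n) ω} := by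
  simp only [Set.ofPred_forall]
  refine MeasurableSet.iInter fun n => MeasurableSet.iInter fun _ => ?_
  exact measurableSet_lt measurable_const
    ((hX.stronglyMeasurable _).measurable.mono (𝓕.le _) le_rfl)

/-- A square integrable martingale started from mean `a > 0` stays positive along a
sequence of times up to `t` with probability at least `a² / E X(t)²`. -/
lemma MeasureTheory.Martingale.le_measureReal_forall_pos [IsFiniteMeasure P]
    {𝓕 : Filtration ℝ≥0 mΩ} {X : ℝ≥0 → Ω → ℝ} (hX : Martingale X 𝓕 P) (e : ℕ → ℝ≥0)
    {t : ℝ≥0} {a q : ℝ} (ha : 0 < a) (hq : 0 < q) (h0 : ∫ ω, X 0 ω ∂P = a)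
    (hX2 : MemLp (X t) 2 P) (hXq : ∫ ω, X t ω ^ 2 ∂P ≤ q) :
    a ^ 2 / q ≤ P.real {ω | ∀ n, e n ≤ t → 0 < X (e n) ω} := by
  let s : ℕ → Finset ℝ≥0 := fun n => ((Finset.range n).image e).filter (· ≤ t)
  let A : ℕ → Set Ω := fun n => {ω | ∀ r ∈ s n, 0 < X r ω}
  have hst : ∀ n, ∀ r ∈ s n, r ≤ t := fun n r hr => (Finset.mem_filter.1 hr).2
  have hAm : ∀ n, MeasurableSet (A n) := fun n =>
    𝓕.le t _ (hX.measurableSet_forall_pos (s n) (hst n))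
  have hle : ∀ n, a ^ 2 / q ≤ P.real (A n) := fun n =>
    le_measureReal_of_le_setIntegral hX2 ha hq hXq
      (h0 ▸ hX.le_setIntegral_forall_pos (s n) t (hst n))
  have hanti : Antitone A := fun m n hmn ω hω r hr => hω r <|
    Finset.filter_subset_filter _ (Finset.image_subset_image (Finset.range_mono hmn)) hr
  have hInter : {ω | ∀ n, e n ≤ t → 0 < X (e n) ω} = ⋂ n, A n := by
    ext ω
    simp only [Set.mem_iInter, Set.mem_ofPred_eq, A, s, Finset.mem_filter, Finset.mem_image,
      Finset.mem_range]
    constructor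
    · rintro h n r ⟨⟨k, -, rfl⟩, hr⟩
      exact h k hr
    · intro h n hn
      exact h (n + 1) (e n) ⟨⟨n, by simp, rfl⟩, hn⟩
  rw [hInter]
  have hlim := tendsto_measure_iInter_atTop (μ := P) (fun n => (hAm n).nullMeasurableSet) hanti
    ⟨0, measure_ne_top _ _⟩
  have hlim' := (ENNReal.tendsto_toReal (measure_ne_top _ _)).comp hlim
  exact ge_of_tendsto' hlim' hle

end Martingale

/-! ### From harmonic tails to an infinite mean. -/

/-- A continuous function that is positive along a dense set of times up to `t` is nonnegative
before `t`. -/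
lemma nonneg_of_forall_denseSeq_pos {f : ℝ≥0 → ℝ} (hf : Continuous f) {e : ℕ → ℝ≥0}
    (he : DenseRange e) {t : ℝ≥0} (h : ∀ n, e n ≤ t → 0 < f (e n)) {s : ℝ≥0} (hs : s < t) :
    0 ≤ f s := by
  by_contra! hneg
  -- The strict `s < t` leaves an open set of times below `t` around `s`.
  obtain ⟨n, hn⟩ := he.exists_mem_open ((isOpen_lt hf continuous_const).inter isOpen_Iio)
    ⟨s, hneg, hs⟩
  exact (h n hn.2.le).not_gt hn.1

/-- Comparison with the harmonic series, by `b + c (n + 1) ≤ (b + c) (n + 1)`. -/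
lemma tsum_ofReal_div_add_mul_succ_eq_top {a b c : ℝ} (ha : 0 < a) (hb : 0 < b) (hc : 0 ≤ c) :
    ∑' n : ℕ, ENNReal.ofReal (a / (b + c * (n + 1))) = ∞ := by
  by_contra h
  have hs := ENNReal.summable_toReal h
  have hnn : ∀ n : ℕ, 0 ≤ a / (b + c * (n + 1)) := fun n => by positivity
  simp_rw [ENNReal.toReal_ofReal (hnn _)] at hs
  have hcmp : ∀ n : ℕ, a / (b + c) * (1 / ((n : ℝ) + 1)) ≤ a / (b + c * (n + 1)) := fun n => by
    rw [div_mul_div_comm, mul_one]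
    gcongr
    nlinarith [n.cast_nonneg (α := ℝ)]
  have hs' := hs.of_nonneg_of_le (fun n => by positivity) hcmp
  rw [summable_mul_left_iff (by positivity)] at hs'
  exact Real.not_summable_one_div_natCast ((summable_nat_add_iff 1).1 (by simpa using hs'))

/-- If `T ≥ n + 1` on `G n` and the probabilities of the `G n` decay at most harmonically, then
`T` has infinite mean. -/
lemma lintegral_eq_top_of_succ_le {Ω : Type*} [MeasurableSpace Ω] {P : Measure Ω}
    {T : Ω → ℝ≥0∞} {G : ℕ → Set Ω} (hG : ∀ n, MeasurableSet (G n))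
    (hT : ∀ᵐ ω ∂P, ∀ n : ℕ, ω ∈ G n → ((n + 1 : ℕ) : ℝ≥0∞) ≤ T ω)
    (hsum : ∑' n, P (G n) = ∞) : ∫⁻ ω, T ω ∂P = ∞ := by
  rw [eq_top_iff, ← hsum]
  calc ∑' n, P (G n) = ∫⁻ ω, ∑' n, (G n).indicator 1 ω ∂P := by
        rw [lintegral_tsum fun n => (measurable_one.indicator (hG n)).aemeasurable]
        simp_rw [lintegral_indicator_one (hG _)]
    _ ≤ ∫⁻ ω, T ω ∂P := by
        refine lintegral_mono_ae ?_
        filter_upwards [hT] with ω hω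
        refine ENNReal.tsum_le_of_sum_range_le fun N => ?_
        induction N with
        | zero => simp
        | succ N ih =>
          -- The `G n` need not be nested: if `ω ∈ G N`, all `N + 1` indicators together are at most
          -- `N + 1 ≤ T ω`; otherwise the last one vanishes.
          by_cases h : ω ∈ G N
          · refine le_trans ?_ (hω N h)
            calc ∑ n ∈ Finset.range (N + 1), (G n).indicator (1 : Ω → ℝ≥0∞) ω
                ≤ ∑ n ∈ Finset.range (N + 1), (1 : ℝ≥0∞) :=
                  Finset.sum_le_sum fun n _ => Set.indicator_le_self' (fun _ _ => zero_le_one) ω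
              _ = ((N + 1 : ℕ) : ℝ≥0∞) := by simp
          · rw [Finset.sum_range_succ, Set.indicator_of_notMem h, add_zero]
            exact ih

lemma IsPushingPath.nonneg {y z : ℝ≥0 → ℝ} (h : IsPushingPath y z) (t : ℝ≥0) : 0 ≤ y t := by
  obtain ⟨-, h0, hy, -⟩ := h
  exact h0 ▸ hy zero_le

lemma IsCompletelyS.isSMatrix {d : ℕ} [NeZero d] {R : Matrix (Fin d) (Fin d) ℝ}
    (hR : IsCompletelyS R) : IsSMatrix R := by
  obtain ⟨w, hw, hRw⟩ := hR Finset.univ Finset.univ_nonempty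
  refine ⟨fun j => w ⟨j, Finset.mem_univ j⟩, fun j => hw _, fun i => ?_⟩
  have h := hRw ⟨i, Finset.mem_univ i⟩
  simp only [Matrix.mulVec, dotProduct, Matrix.submatrix_apply] at h ⊢
  rwa [← Fintype.sum_equiv (Equiv.subtypeUnivEquiv Finset.mem_univ)
    (fun j : (Finset.univ : Finset (Fin d)) => R i j * w j) _ fun j => rfl]

/-- Evaluate `u' R w` in two ways: it is nonnegative as `(u' R) · w`, but would be negative as `u ·
(R w)` if `u ≤ 0`. -/
lemma IsSMatrix.exists_pos_of_vecMul_nonneg {ι : Type*} [Fintype ι] {R : Matrix ι ι ℝ}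
    (hR : IsSMatrix R) {u : ι → ℝ} (hu : u ≠ 0) (huR : ∀ j, 0 ≤ (u ᵥ* R) j) : ∃ j, 0 < u j := by
  obtain ⟨w, hw, hRw⟩ := hR
  by_contra! hneg
  obtain ⟨i, hi⟩ := Function.ne_iff.1 hu
  have h1 : 0 ≤ u ⬝ᵥ R *ᵥ w := by
    rw [Matrix.dotProduct_mulVec]
    exact Finset.sum_nonneg fun j _ => mul_nonneg (huR j) (hw j)
  refine h1.not_gt (Finset.sum_neg' (fun j _ => ?_) ⟨i, Finset.mem_univ i, ?_⟩)
  · exact mul_nonpos_of_nonpos_of_nonneg (hneg j) (hRw j).le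
  · exact mul_neg_of_neg_of_pos (lt_of_le_of_ne (hneg i) hi) (hRw i)

/-! ### Comparison of `u · Z` with Brownian motion. -/

namespace IsSRBMRepresentation

variable {d : ℕ} {Ω : Type*} [MeasurableSpace Ω] {𝓕 : Filtration ℝ≥0 ‹MeasurableSpace Ω›}
  {θ x : EuclideanSpace ℝ (Fin d)} {Γ R : Matrix (Fin d) (Fin d) ℝ}
  {Z W Y : ℝ≥0 → Ω → EuclideanSpace ℝ (Fin d)} {P : Measure Ω}

lemma dotProduct_eq (h : IsSRBMRepresentation 𝓕 θ Γ R Z x P W Y) (u : Fin d → ℝ) :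
    ∀ᵐ ω ∂P, ∀ t : ℝ≥0, u ⬝ᵥ (Z t ω).ofLp =
      u ⬝ᵥ (W t ω).ofLp + (u ⬝ᵥ θ.ofLp) * t + (u ᵥ* R) ⬝ᵥ (Y t ω).ofLp := by
  filter_upwards [h.decomposition] with ω hω t
  have : (Z t ω).ofLp = (W t ω).ofLp + (t : ℝ) • θ.ofLp + R *ᵥ (Y t ω).ofLp := by
    ext i
    simp [hω t i, Matrix.mulVec, dotProduct, mul_comm]
  rw [this, dotProduct_add, dotProduct_add, dotProduct_smul, Matrix.dotProduct_mulVec, smul_eq_mul,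
    mul_comm (t : ℝ)]

lemma le_dotProduct (h : IsSRBMRepresentation 𝓕 θ Γ R Z x P W Y) {u : Fin d → ℝ}
    (huR : ∀ j, 0 ≤ (u ᵥ* R) j) :
    ∀ᵐ ω ∂P, ∀ t : ℝ≥0,
      u ⬝ᵥ (W t ω).ofLp + (u ⬝ᵥ θ.ofLp) * t ≤ u ⬝ᵥ (Z t ω).ofLp := by
  filter_upwards [h.dotProduct_eq u, h.pushing] with ω hω hY t
  rw [hω t]
  exact le_add_of_nonneg_right
    (Finset.sum_nonneg fun j _ => mul_nonneg (huR j) ((hY j).nonneg t))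

/-- The mean hitting time of a set that lies strictly below the starting point in a direction `u`
with `u' R ≥ 0` and `u · θ ≥ 0` is infinite. -/
lemma lintegral_hitTime_eq_top [IsProbabilityMeasure P]
    (h : IsSRBMRepresentation 𝓕 θ Γ R Z x P W Y) (hΓ : Γ.PosDef) {u : Fin d → ℝ}
    (huR : ∀ j, 0 ≤ (u ᵥ* R) j) (huθ : 0 ≤ u ⬝ᵥ θ.ofLp)
    {A : Set (EuclideanSpace ℝ (Fin d))} {c : ℝ} (hA : ∀ z ∈ A, u ⬝ᵥ z.ofLp < c)
    (hx : c < u ⬝ᵥ x.ofLp) : ∫⁻ ω, hitTime Z A ω ∂P = ∞ := by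
  let X : ℝ≥0 → Ω → ℝ := fun t ω => u ⬝ᵥ (W t ω).ofLp - c
  have hX : Martingale X 𝓕 P := by
    have := (h.martingale.continuousLinearMap_comp (dotProductCLM u)).sub
      (martingale_const 𝓕 P c)
    convert this using 2 with t
    ext ω
    simp [X, dotProductCLM_apply]
  set a := u ⬝ᵥ x.ofLp - c with ha_def
  set v := u ⬝ᵥ Γ *ᵥ u with hv_def
  have ha : 0 < a := sub_pos.2 hx
  have hv : 0 ≤ v := by simpa using hΓ.posSemidef.dotProduct_mulVec_nonneg u
  have h0 : ∫ ω, X 0 ω ∂P = a := by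
    rw [integral_congr_ae (g := fun _ => a)]
    · simp
    · filter_upwards [h.brownian.start] with ω hω
      simp [X, hω, a]
  let e := TopologicalSpace.denseSeq ℝ≥0
  -- Countably many times keep the event measurable; path continuity recovers the times in between.
  let G : ℕ → Set Ω := fun n => {ω | ∀ k, e k ≤ (n + 1 : ℕ) → 0 < X (e k) ω}
  refine lintegral_eq_top_of_succ_le (G := G)
    (fun n => hX.measurableSet_forall_seq_pos e _) ?_ ?_
  · filter_upwards [h.le_dotProduct huR, h.brownian.cont] with ω hle hcont n hω
    refine le_iInf₂ fun s hs => ?_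
    by_contra! hlt
    have hXc : Continuous fun t => X t ω := by
      have : Continuous fun t => dotProductCLM u (W t ω) := (dotProductCLM u).continuous.comp hcont
      simp only [dotProductCLM_apply] at this
      exact this.sub continuous_const
    have hpos := nonneg_of_forall_denseSeq_pos hXc (TopologicalSpace.denseRange_denseSeq ℝ≥0) hω
      (s := s) (by exact_mod_cast hlt)
    have h1 := hle s
    have h2 := hA _ hs
    have h3 : 0 ≤ (u ⬝ᵥ θ.ofLp) * (s : ℝ) := by positivity
    simp only [X] at hpos
    linarith
  · rw [eq_top_iff, ← tsum_ofReal_div_add_mul_succ_eq_top (pow_pos ha 2) (pow_pos ha 2) hv]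
    refine ENNReal.tsum_le_tsum fun n => ENNReal.ofReal_le_of_le_toReal ?_
    refine hX.le_measureReal_forall_pos e ha (by positivity) h0
      (h.brownian.memLp_two_dotProduct_sub hΓ u c _) ?_
    rw [h.brownian.integral_dotProduct_sub_sq hΓ u c]
    simp [a, v]

end IsSRBMRepresentation

/-! ### Starting points, and the unit ball of the orthant as a target. -/

lemma dotProduct_le_sum_abs_of_mem_orthantBall {d : ℕ} (u : Fin d → ℝ)
    {z : EuclideanSpace ℝ (Fin d)} (hz : z ∈ orthantBall d) : u ⬝ᵥ z.ofLp ≤ ∑ j, |u j| := by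
  refine Finset.sum_le_sum fun j _ => (le_abs_self _).trans ?_
  rw [abs_mul]
  have : |z j| ≤ 1 := (PiLp.norm_apply_le z j).trans hz.2
  nlinarith [abs_nonneg (u j)]

lemma exists_mem_orthant_lt_dotProduct {d : ℕ} {u : Fin d → ℝ} {j : Fin d} (hj : 0 < u j)
    (c : ℝ) : ∃ x ∈ orthant d, 1 < ‖x‖ ∧ c < u ⬝ᵥ x.ofLp := by
  have hr : 0 ≤ |c| / u j + 2 := by positivity
  -- The quotient makes `u · x` exceed `c`; the summand `2` makes the norm exceed `1`.
  refine ⟨PiLp.single 2 j (|c| / u j + 2), fun i => ?_, ?_, ?_⟩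
  · rw [PiLp.single_apply]
    split_ifs <;> simp [hr]
  · rw [PiLp.norm_single, Real.norm_of_nonneg hr]
    have : 0 ≤ |c| / u j := by positivity
    linarith
  · have : u ⬝ᵥ (PiLp.single 2 j (|c| / u j + 2)).ofLp = |c| + 2 * u j := by
      simp
      field_simp
    rw [this]
    linarith [le_abs_self c]

lemma isClosed_orthantBall (d : ℕ) : IsClosed (orthantBall d) := by
  have : orthantBall d = (⋂ i, {z | 0 ≤ z i}) ∩ Metric.closedBall 0 1 := by
    ext z
    simp [orthantBall, orthant]
  rw [this]
  refine (isClosed_iInter fun i => isClosed_le continuous_const ?_).inter Metric.isClosed_closedBall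
  fun_prop

lemma volume_orthantBall_pos (d : ℕ) : 0 < volume (orthantBall d) := by
  let U : Set (EuclideanSpace ℝ (Fin d)) := (⋂ i, {z | 0 < z i}) ∩ Metric.ball 0 1
  have hU : IsOpen U := by
    refine (isOpen_iInter_of_finite fun i => isOpen_lt continuous_const ?_).inter Metric.isOpen_ball
    fun_prop
  have hUs : U ⊆ orthantBall d := fun z hz =>
    ⟨fun i => (Set.mem_iInter.1 hz.1 i).le, (mem_ball_zero_iff.1 hz.2).le⟩
  refine (hU.measure_pos volume ?_).trans_le (measure_mono hUs)
  let y : EuclideanSpace ℝ (Fin d) := WithLp.toLp 2 fun _ => 1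
  have hy : 0 < ‖y‖ + 1 := by positivity
  refine ⟨(‖y‖ + 1)⁻¹ • y, Set.mem_iInter.2 fun i => ?_, ?_⟩
  · simp [y]
    positivity
  · rw [mem_ball_zero_iff, norm_smul, norm_inv, Real.norm_of_nonneg hy.le, inv_mul_lt_iff₀ hy]
    linarith

section HasInfiniteMeanStart

variable {d : ℕ} {Ω : Type*} [MeasurableSpace Ω] {𝓕 : Filtration ℝ≥0 ‹MeasurableSpace Ω›}
  {θ : EuclideanSpace ℝ (Fin d)} {Γ R : Matrix (Fin d) (Fin d) ℝ}
  {Z : ℝ≥0 → Ω → EuclideanSpace ℝ (Fin d)} {P : orthant d → Measure Ω} {u : Fin d → ℝ}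

lemma IsSRBM.hasInfiniteMeanStart (hZ : IsSRBM 𝓕 θ Γ R Z P) (hΓ : Γ.PosDef)
    (hR : IsCompletelyS R) (hu : u ≠ 0) (huR : ∀ j, 0 ≤ (u ᵥ* R) j) (huθ : 0 ≤ u ⬝ᵥ θ.ofLp) :
    HasInfiniteMeanStart Z P u := by
  obtain ⟨i, -⟩ := Function.ne_iff.1 hu
  have : NeZero d := ⟨fun h => (Fin.cast h i).elim0⟩
  obtain ⟨j, hj⟩ := hR.isSMatrix.exists_pos_of_vecMul_nonneg hu huR
  obtain ⟨x, hx, hx1, hxu⟩ := exists_mem_orthant_lt_dotProduct hj (∑ j, |u j| + 1)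
  have hA : ∀ z ∈ orthantBall d, u ⬝ᵥ z.ofLp < ∑ j, |u j| + 1 := fun z hz =>
    (dotProduct_le_sum_abs_of_mem_orthantBall u hz).trans_lt (lt_add_one _)
  obtain ⟨W, Y, h⟩ := hZ.representation ⟨x, hx⟩
  have := hZ.isProb ⟨x, hx⟩
  exact ⟨⟨x, hx⟩, hx1, fun z hz => (hA z hz).trans hxu,
    h.lintegral_hitTime_eq_top hΓ huR huθ hA hxu⟩

lemma HasInfiniteMeanStart.not_isPositiveRecurrent (h : HasInfiniteMeanStart Z P u) :
    ¬ IsPositiveRecurrent Z P := fun hrec => by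
  obtain ⟨x, -, -, hx⟩ := h
  exact (hrec _ (fun z hz => hz.1) (isClosed_orthantBall d) (volume_orthantBall_pos d) x).ne hx

/-- As `Z` stays in the orthant, entering the open unit ball means entering `orthantBall`, so the
ball is hit no earlier. -/
lemma HasInfiniteMeanStart.not_isPositiveRecurrentAtOrigin (hZ : IsSRBM 𝓕 θ Γ R Z P)
    (h : HasInfiniteMeanStart Z P u) : ¬ IsPositiveRecurrentAtOrigin Z P := fun hrec => by
  obtain ⟨x, -, -, hx⟩ := h
  refine (hrec (Metric.ball 0 1) Metric.isOpen_ball (by simp) x).not_ge ?_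
  rw [← hx]
  refine lintegral_mono_ae ?_
  filter_upwards [hZ.mem_orthant x] with ω hω
  exact le_iInf₂ fun t ht => iInf₂_le t ⟨hω t, (mem_ball_zero_iff.1 ht).le⟩

end HasInfiniteMeanStart

/-! ### The choice of the direction `u`, and the conclusion. -/

lemma Matrix.exists_vecMul_eq_zero_dotProduct_nonneg {ι : Type*} [Fintype ι] [DecidableEq ι]
    {R : Matrix ι ι ℝ} (hR : ¬ IsUnit R) (θ : ι → ℝ) :
    ∃ u : ι → ℝ, u ≠ 0 ∧ u ᵥ* R = 0 ∧ 0 ≤ u ⬝ᵥ θ := by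
  rw [Matrix.isUnit_iff_isUnit_det, isUnit_iff_ne_zero, not_not] at hR
  obtain ⟨u, hu, huR⟩ := Matrix.exists_vecMul_eq_zero_iff.2 hR
  rcases le_total 0 (u ⬝ᵥ θ) with h | h
  · exact ⟨u, hu, huR, h⟩
  · exact ⟨-u, neg_ne_zero.2 hu, by simp [Matrix.neg_vecMul, huR], by simpa using h⟩

lemma Matrix.row_inv_vecMul {ι : Type*} [Fintype ι] [DecidableEq ι]
    {R : Matrix ι ι ℝ} (hR : IsUnit R) (i : ι) : R⁻¹ i ᵥ* R = Pi.single i 1 := by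
  have h := congrFun (Matrix.nonsing_inv_mul R ((Matrix.isUnit_iff_isUnit_det R).1 hR)) i
  ext j
  refine (congrFun h j).trans ?_
  simp [Matrix.one_apply, Pi.single_apply, eq_comm]

theorem mainTheorem3 {d : ℕ} {Ω : Type*} [MeasurableSpace Ω]
    (𝓕 : Filtration ℝ≥0 ‹MeasurableSpace Ω›)
    (θ : EuclideanSpace ℝ (Fin d)) (Γ R : Matrix (Fin d) (Fin d) ℝ)
    (hΓ : Γ.PosDef) (hR : IsCompletelyS R)
    (Z : ℝ≥0 → Ω → EuclideanSpace ℝ (Fin d)) (P : orthant d → Measure Ω)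
    (hZ : IsSRBM 𝓕 θ Γ R Z P) :
    -- necessity, for both definitions of positive recurrence
    (IsPositiveRecurrent Z P → IsUnit R ∧ ∀ i, (R⁻¹ *ᵥ θ.ofLp) i < 0) ∧
    (IsPositiveRecurrentAtOrigin Z P → IsUnit R ∧ ∀ i, (R⁻¹ *ᵥ θ.ofLp) i < 0) ∧
    -- `R` nonsingular and `R⁻¹ θ < 0` fails in coordinate `i`; `u` is row `i` of `R⁻¹`
    (IsUnit R → ∀ i, 0 ≤ (R⁻¹ *ᵥ θ.ofLp) i →
      (∀ x : orthant d, ∃ β : ℝ≥0 → Ω → ℝ,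
        IsLinearBrownianMotion (R⁻¹ i ⬝ᵥ x.1.ofLp) ((R⁻¹ *ᵥ θ.ofLp) i)
          (R⁻¹ i ⬝ᵥ Γ *ᵥ R⁻¹ i) β (P x) ∧
        ∀ᵐ ω ∂P x, ∀ t, β t ω ≤ R⁻¹ i ⬝ᵥ (Z t ω).ofLp) ∧
      HasInfiniteMeanStart Z P (R⁻¹ i)) ∧
    -- `R` singular
    (¬ IsUnit R → ∃ u : Fin d → ℝ, u ≠ 0 ∧ u ᵥ* R = 0 ∧ 0 ≤ u ⬝ᵥ θ.ofLp ∧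
      (∀ x : orthant d,
        IsLinearBrownianMotion (u ⬝ᵥ x.1.ofLp) (u ⬝ᵥ θ.ofLp) (u ⬝ᵥ Γ *ᵥ u)
          (fun t ω => u ⬝ᵥ (Z t ω).ofLp) (P x)) ∧
      HasInfiniteMeanStart Z P u) := by
  have singular (hU : ¬ IsUnit R) : ∃ u : Fin d → ℝ, u ≠ 0 ∧ u ᵥ* R = 0 ∧ 0 ≤ u ⬝ᵥ θ.ofLp ∧
      (∀ x : orthant d,
        IsLinearBrownianMotion (u ⬝ᵥ x.1.ofLp) (u ⬝ᵥ θ.ofLp) (u ⬝ᵥ Γ *ᵥ u)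
          (fun t ω => u ⬝ᵥ (Z t ω).ofLp) (P x)) ∧
      HasInfiniteMeanStart Z P u := by
    obtain ⟨u, hu, huR, huθ⟩ := Matrix.exists_vecMul_eq_zero_dotProduct_nonneg hU θ.ofLp
    refine ⟨u, hu, huR, huθ, fun x => ?_, hZ.hasInfiniteMeanStart hΓ hR hu (by simp [huR]) huθ⟩
    obtain ⟨W, Y, h⟩ := hZ.representation x
    refine h.brownian.isLinearBrownianMotion_dotProduct hΓ hu _ ?_
    filter_upwards [h.dotProduct_eq u] with ω hω t
    simp [hω t, huR]
  have nonsingular (hU : IsUnit R) (i : Fin d) (hi : 0 ≤ (R⁻¹ *ᵥ θ.ofLp) i) :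
      (∀ x : orthant d, ∃ β : ℝ≥0 → Ω → ℝ,
        IsLinearBrownianMotion (R⁻¹ i ⬝ᵥ x.1.ofLp) ((R⁻¹ *ᵥ θ.ofLp) i)
          (R⁻¹ i ⬝ᵥ Γ *ᵥ R⁻¹ i) β (P x) ∧
        ∀ᵐ ω ∂P x, ∀ t, β t ω ≤ R⁻¹ i ⬝ᵥ (Z t ω).ofLp) ∧
      HasInfiniteMeanStart Z P (R⁻¹ i) := by
    have huR := Matrix.row_inv_vecMul hU i
    have hu : R⁻¹ i ≠ 0 := fun h => by simp [h, eq_comm] at huR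
    have huR' : ∀ j, 0 ≤ (R⁻¹ i ᵥ* R) j := fun j => by
      rw [huR, Pi.single_apply]
      split_ifs <;> norm_num
    refine ⟨fun x => ?_, hZ.hasInfiniteMeanStart hΓ hR hu huR' hi⟩
    obtain ⟨W, Y, h⟩ := hZ.representation x
    exact ⟨_, h.brownian.isLinearBrownianMotion_dotProduct hΓ hu _
      (Filter.Eventually.of_forall fun _ _ => rfl), h.le_dotProduct huR'⟩
  have necessity (hrec : ∀ u, ¬ HasInfiniteMeanStart Z P u) :
      IsUnit R ∧ ∀ i, (R⁻¹ *ᵥ θ.ofLp) i < 0 := by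
    have hU : IsUnit R := by
      by_contra hU
      obtain ⟨u, -, -, -, -, h⟩ := singular hU
      exact hrec u h
    refine ⟨hU, fun i => ?_⟩
    by_contra! hi
    exact hrec _ (nonsingular hU i hi).2
  exact ⟨fun hrec => necessity fun u h => h.not_isPositiveRecurrent hrec,
    fun hrec => necessity fun u h => h.not_isPositiveRecurrentAtOrigin hZ hrec,
    nonsingular, singular⟩
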